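/- **Setting.** Let $\mathbb X,\mathbb Y$ be locally compact Polish spaces with their Borel $\sigma$-algebras, let $\lambda$ and $\nu$ be locally finite positive measures on $\mathbb X$ and $\mathbb Y$, and let $U:\mathbb X\to\mathbb R$, $V:\mathbb Y\to\mathbb R$, $W:\mathbb X\times\mathbb Y\to\mathbb R$ be measurable and locally bounded, with $\sup e^{-W}<\infty$. Assume that $U$ and $V$ have compact sub-level sets, that $\mu(dx):=e^{-U(x)}\lambda(dx)$ and $\eta(dy):=e^{-V(y)}\nu(dy)$ are probability measures, and that $\mathcal K_0(x,dy):=e^{-W(x,y)}\nu(dy)$ is a Markov transition from $\mathbb X$ to $\mathbb Y$. The Sinkhorn transitions $\mathcal K_{2n}(x,dy)=k_{2n}(x,y)\,\nu(dy)$ and $\mathcal K_{2n+1}(y,dx)=k_{2n+1}(y,x)\,\lambda(dx)$ are defined for $n\ge 0$ by $k_0=e^{-W}$ and Bayes' rule $$k_{2n+1}(y,x)=\frac{e^{-U(x)}k_{2n}(x,y)}{\int e^{-U(x')}k_{2n}(x',y)\,\lambda(dx')},\qquad k_{2n+2}(x,y)=\frac{e^{-V(y)}k_{2n+1}(y,x)}{\int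 e^{-V(y')}k_{2n+1}(y',x)\,\nu(dy')},$$ and the Sinkhorn marginals are $\pi_{2n}:=\mu\mathcal K_{2n}$ and $\pi_{2n+1}:=\eta\mathcal K_{2n+1}$. For a positive function $g$ and probability measures $\mu_1,\mu_2$ put $|||\mu_1-\mu_2|||_g:=|\mu_1-\mu_2|(g)$, where $|\cdot|$ is the total variation measure. For a Markov transition $K$ let $\mathrm{lip}_{g,h}(K):=\sup |||\mu_1K-\mu_2K|||_h/|||\mu_1-\mu_2|||_g$, the supremum over probability measures with $\mu_1(g),\mu_2(g)<\infty$ and $|||\mu_1-\mu_2|||_g>0$, and let $\|f\|_g:=\sup|f/g|$. Let $\mathcal B_0(\mathbb X)$ be the set of functions $\theta>0$ on $\mathbb X$ such that $1/\theta$ is locally bounded above, bounded below by a positive constant, and has compact sub-level sets; likewise $\mathcal B_0(\mathbb Y)$. **Condition (A)**, for $\delta\in\,]0,1/2[$: $\int e^{-(1-2\delta)U}d\lambda<\infty$ and $\int e^{-(1-2\delta)V}d\nu<\infty$; the functions $W^V(x):=\int W(x,y)\,\eta(dy)$ and $W_U(y):=\int W(x,y)\,\mu(dx)$ are finite; and there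 are $\theta_u\in\mathcal B_0(\mathbb X)$, $\theta_v\in\mathcal B_0(\mathbb Y)$ with $e^{-(\delta U-W^V)}\le\theta_u$ and $e^{-(\delta V-W_U)}\le\theta_v$. **Theorem.** Assume (A) holds for $\delta$, and set $g:=e^{\delta U}$, $h:=e^{\delta V}$. Then all $\mathcal K_n$, $n\ge0$, are well-defined Markov transitions, and there are $a>0$ and $\varrho\in\,]0,1[$ such that for every $n\ge 1$ $$\mathrm{lip}_{g_a,h_a}(\mathcal K_{2n})\vee \mathrm{lip}_{h_a,g_a}(\mathcal K_{2n+1})\le\varrho,\qquad g_a:=\tfrac12+a\,g,\quad h_a:=\tfrac12+a\,h .$$ In addition, $$\sup_{n\ge1}\big(\pi_{2n}(h)\vee\pi_{2n+1}(g)\big)<\infty\quad\text{and}\quad \sup_{n\ge1}\big(\|\mathcal K_{2n}(h)\|_g\vee\|\mathcal K_{2n+1}(g)\|_h\big)<\infty .$$ -/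

import Mathlib

open MeasureTheory ProbabilityTheory Set
open scoped ENNReal Topology

noncomputable section

namespace Sinkhorn

/-- A real function is locally bounded: it is bounded near every point. -/
def LocallyBdd {Z : Type*} [TopologicalSpace Z] (f : Z → ℝ) : Prop :=
  ∀ z, ∃ N ∈ 𝓝 z, ∃ C : ℝ, ∀ w ∈ N, |f w| ≤ C

/-- The class `B_∞(Z)`: locally upper bounded, uniformly positive functions whose sub-level sets
are compact. -/
def MemBInf {Z : Type*} [TopologicalSpace Z] (f : Z → ℝ) : Prop :=
  (∀ z, ∃ N ∈ 𝓝 z, ∃ C : ℝ, ∀ w ∈ N, f w ≤ C) ∧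
  (∃ c : ℝ, 0 < c ∧ ∀ z, c ≤ f z) ∧
  (∀ r : ℝ, IsCompact {z | f z ≤ r})

/-- The class `B_0(Z)`: positive functions `θ` with `1/θ` in `B_∞(Z)`. -/
def MemBZero {Z : Type*} [TopologicalSpace Z] (θ : Z → ℝ) : Prop :=
  (∀ z, 0 < θ z) ∧ MemBInf (fun z => 1 / θ z)

/-- The Gibbs measure `lam_U(dz) = e^{-U(z)} lam(dz)`. -/
def gibbs {Z : Type*} [MeasurableSpace Z] (lam : Measure Z) (U : Z → ℝ) : Measure Z :=
  lam.withDensity (fun z => ENNReal.ofReal (Real.exp (-U z)))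

/-- Condition (A) for a given exponent `δ`, with `W^V(x) = ∫ W(x,y) nu_V(dy)` and
`W_U(y) = ∫ W(x,y) lam_U(dx)`. Integrability says that these two functions are real valued; for `W`
bounded below it is implied by the domination of `e^{W^V - δU}` and `e^{W_U - δV}` by real
functions. -/
def ConditionA {X Y : Type*} [TopologicalSpace X] [MeasurableSpace X] [TopologicalSpace Y]
    [MeasurableSpace Y] (lam : Measure X) (nu : Measure Y) (U : X → ℝ) (V : Y → ℝ)
    (W : X → Y → ℝ) (δ : ℝ) : Prop :=
  0 < δ ∧ δ < 1 / 2 ∧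
  gibbs lam (fun x => (1 - 2 * δ) * U x) univ < ∞ ∧
  gibbs nu (fun y => (1 - 2 * δ) * V y) univ < ∞ ∧
  (∀ x, Integrable (fun y => W x y) (gibbs nu V)) ∧
  (∀ y, Integrable (fun x => W x y) (gibbs lam U)) ∧
  ∃ (θu : X → ℝ) (θv : Y → ℝ), MemBZero θu ∧ MemBZero θv ∧
    (∀ x, Real.exp (-(δ * U x - ∫ y, W x y ∂(gibbs nu V))) ≤ θu x) ∧
    (∀ y, Real.exp (-(δ * V y - ∫ x, W x y ∂(gibbs lam U))) ≤ θv y)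

/-- Bayes' rule for densities. If `k(x,·)` is the density of a transition `K(x,dy)` with respect to
some reference measure and `μ = lam_U`, then `bayesDual lam U k y` is the `lam`-density of the dual
transition `K^*_μ(y,dx) = μ(dx) (dδ_xK/dμK)(y)`, where
`(dδ_xK/dμK)(y) = k(x,y) / ∫ k(x',y) μ(dx')`. -/
def bayesDual {X Y : Type*} [MeasurableSpace X] (lam : Measure X) (U : X → ℝ)
    (k : X → Y → ℝ≥0∞) : Y → X → ℝ≥0∞ := fun y x =>
  ENNReal.ofReal (Real.exp (-U x)) * k x y /
    ∫⁻ x', ENNReal.ofReal (Real.exp (-U x')) * k x' y ∂lam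

variable {X Y : Type*} [MeasurableSpace X] [MeasurableSpace Y]

/-- The `nu`-density of the Sinkhorn transition `𝒦_{2n}`: `𝒦_0(x,dy) = e^{-W(x,y)} nu(dy)`, and
`𝒦_{2(n+1)}` is the dual with respect to `η = nu_V` of `𝒦_{2n+1}`, itself the dual with respect to
`μ = lam_U` of `𝒦_{2n}`. -/
def evenDensity (lam : Measure X) (nu : Measure Y) (U : X → ℝ) (V : Y → ℝ) (W : X → Y → ℝ) :
    ℕ → X → Y → ℝ≥0∞
  | 0 => fun x y => ENNReal.ofReal (Real.exp (-W x y))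
  | n + 1 => bayesDual nu V (bayesDual lam U (evenDensity lam nu U V W n))

/-- The `lam`-density of the Sinkhorn transition `𝒦_{2n+1}`. -/
def oddDensity (lam : Measure X) (nu : Measure Y) (U : X → ℝ) (V : Y → ℝ) (W : X → Y → ℝ)
    (n : ℕ) : Y → X → ℝ≥0∞ :=
  bayesDual lam U (evenDensity lam nu U V W n)

/-- The Sinkhorn transition `𝒦_{2n}` from `X` to `Y`. -/
def kernelEven (lam : Measure X) (nu : Measure Y) [SFinite nu] (U : X → ℝ) (V : Y → ℝ)
    (W : X → Y → ℝ) (n : ℕ) : Kernel X Y :=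
  (Kernel.const X nu).withDensity (evenDensity lam nu U V W n)

/-- The Sinkhorn transition `𝒦_{2n+1}` from `Y` to `X`. -/
def kernelOdd (lam : Measure X) [SFinite lam] (nu : Measure Y) (U : X → ℝ) (V : Y → ℝ)
    (W : X → Y → ℝ) (n : ℕ) : Kernel Y X :=
  (Kernel.const Y lam).withDensity (oddDensity lam nu U V W n)

/-- The Sinkhorn marginal `π_{2n} = μ 𝒦_{2n}`, with `μ = lam_U`. -/
def piEven (lam : Measure X) (nu : Measure Y) [SFinite nu] (U : X → ℝ) (V : Y → ℝ)
    (W : X → Y → ℝ) (n : ℕ) : Measure Y :=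
  (gibbs lam U).bind (kernelEven lam nu U V W n)

/-- The Sinkhorn marginal `π_{2n+1} = η 𝒦_{2n+1}`, with `η = nu_V`. -/
def piOdd (lam : Measure X) [SFinite lam] (nu : Measure Y) (U : X → ℝ) (V : Y → ℝ)
    (W : X → Y → ℝ) (n : ℕ) : Measure X :=
  (gibbs nu V).bind (kernelOdd lam nu U V W n)

/-- The `g`-weighted total variation norm `|μ₁ - μ₂|(g)`, where `μ₁ - μ₂` and `μ₂ - μ₁` (truncated
differences of measures) are the positive and negative parts of the signed measure `μ₁ - μ₂`;
see `weightedTV_eq`. -/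
def weightedTV (g : X → ℝ) (μ₁ μ₂ : Measure X) : ℝ≥0∞ :=
  ∫⁻ x, ENNReal.ofReal (g x) ∂((μ₁ - μ₂) + (μ₂ - μ₁))

theorem weightedTV_eq (g : X → ℝ) (μ₁ μ₂ : Measure X) [IsFiniteMeasure μ₁] [IsFiniteMeasure μ₂] :
    weightedTV g μ₁ μ₂ =
      ∫⁻ x, ENNReal.ofReal (g x) ∂(μ₁.toSignedMeasure - μ₂.toSignedMeasure).totalVariation := by
  rw [weightedTV, SignedMeasure.totalVariation, Measure.toJordanDecomposition_toSignedMeasure_sub]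
  rfl

/-- The Lipschitz constant `lip_{g,h}(K)`: the supremum of `|||μ₁K - μ₂K|||_h / |||μ₁ - μ₂|||_g` over
the probability measures `μ₁, μ₂` integrating `g` with `|||μ₁ - μ₂|||_g > 0`. -/
def lip (g : X → ℝ) (h : Y → ℝ) (K : Kernel X Y) : ℝ≥0∞ :=
  ⨆ (μ₁ : Measure X) (μ₂ : Measure X) (_ : IsProbabilityMeasure μ₁) (_ : IsProbabilityMeasure μ₂)
    (_ : ∫⁻ x, ENNReal.ofReal (g x) ∂μ₁ < ∞) (_ : ∫⁻ x, ENNReal.ofReal (g x) ∂μ₂ < ∞)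
    (_ : 0 < weightedTV g μ₁ μ₂),
    weightedTV h (μ₁.bind K) (μ₂.bind K) / weightedTV g μ₁ μ₂

/-- The weighted norm `‖K(h)‖_g = sup_x K(h)(x) / g(x)` for positive functions `g`, `h`. -/
def weightedNorm (g : X → ℝ) (h : Y → ℝ) (K : Kernel X Y) : ℝ≥0∞ :=
  ⨆ x, (∫⁻ y, ENNReal.ofReal (h y) ∂(K x)) / ENNReal.ofReal (g x)

end Sinkhorn

end

noncomputable section

namespace Sinkhorn

/-! Every Sinkhorn density factors as `e^{-U} α e^{-W} β` (or its mirror image with `V`), and Bayes'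
rule only replaces one potential by `dualPot` of the other. Uniformity in `n` therefore reduces to
two-sided bounds on the product of two consecutive potentials; separately they need not be bounded
uniformly.

These bounds come from the dual objective `∫ log α dμ + ∫ log β dη`. It starts at or above `-log C`
and never decreases (`CostBounds.integral_log_le`). Jensen bounds an update above by `e^{W_U}` times
`e^{-∫ log α}`; multiplying two such bounds leaves the exponential of minus the objective, at most
`C` (`SinkhornPair.mul_next_le`). Integrating the Jensen bound and updating again gives a lower
bound by `e^{∫ log α}`, and the product of two of these is again controlled by the objective
(`SinkhornPair.le_mul_next`).

Hence, for `n ≥ 1`, all transitions share a bound `K(h) ≤ B e^{W^V}` and a minorization by `κ e^{-W}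
η` (`transitionBounds_of_density`). Condition (A) turns the first into a drift inequality `K(h) ≤
g/4 + c`, and local boundedness of `W` turns the second into one minorizing measure on a compact
sub-level set. A Harris-type argument in weighted total variation,
`lip_le_of_drift_of_minorization`, then gives a contraction rate depending only on these constants.
-/

/-- A measurable integrable function bounded below by a positive constant. -/
structure IsPotential {X : Type*} [MeasurableSpace X] (μ : Measure X) (f : X → ℝ) : Prop where
  measurable : Measurable f
  lower : ∃ c : ℝ, 0 < c ∧ ∀ x, c ≤ f x
  integrable : Integrable f μ

/-- The Sinkhorn update `y ↦ 1 / ∫ e^{-W(x,y)} α(x) μ(dx)`. -/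
def dualPot {X Y : Type*} [MeasurableSpace X] (μ : Measure X) (W : X → Y → ℝ) (α : X → ℝ)
    (y : Y) : ℝ :=
  (∫ x, Real.exp (-W x y) * α x ∂μ)⁻¹

/-- Quantitative hypotheses on a cost function `W`, symmetric in the two spaces. -/
structure CostBounds {X Y : Type*} [MeasurableSpace X] [MeasurableSpace Y] (μ : Measure X)
    (η : Measure Y) (W : X → Y → ℝ) (C D : ℝ) : Prop where
  measurable : Measurable (Function.uncurry W)
  one_le_C : 1 ≤ C
  one_le_D : 1 ≤ D
  exp_le : ∀ x y, Real.exp (-W x y) ≤ C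
  integrable_left : ∀ y, Integrable (fun x => W x y) μ
  integrable_right : ∀ x, Integrable (fun y => W x y) η
  integrable_exp_left : Integrable (fun y => Real.exp (∫ x, W x y ∂μ)) η
  integrable_exp_right : Integrable (fun x => Real.exp (∫ y, W x y ∂η)) μ
  integral_exp_left : ∫ y, Real.exp (∫ x, W x y ∂μ) ∂η ≤ D
  integral_exp_right : ∫ x, Real.exp (∫ y, W x y ∂η) ∂μ ≤ D

/-! ### Bounds for one or two Sinkhorn updates, and monotonicity of the dual objective. -/

section Potentials

variable {X Y : Type*} [MeasurableSpace X] [MeasurableSpace Y] {μ : Measure X} {η : Measure Y}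
  {W : X → Y → ℝ} {C D : ℝ} {α : X → ℝ}

theorem CostBounds.swap (hW : CostBounds μ η W C D) :
    CostBounds η μ (fun y x => W x y) C D where
  measurable := hW.measurable.comp measurable_swap
  one_le_C := hW.one_le_C
  one_le_D := hW.one_le_D
  exp_le y x := hW.exp_le x y
  integrable_left := hW.integrable_right
  integrable_right := hW.integrable_left
  integrable_exp_left := hW.integrable_exp_right
  integrable_exp_right := hW.integrable_exp_left
  integral_exp_left := hW.integral_exp_right
  integral_exp_right := hW.integral_exp_left

theorem IsPotential.pos (hα : IsPotential μ α) (x : X) : 0 < α x := by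
  obtain ⟨c, hc, h⟩ := hα.lower
  exact hc.trans_le (h x)

theorem IsPotential.integral_pos [IsProbabilityMeasure μ] (hα : IsPotential μ α) :
    0 < ∫ x, α x ∂μ := by
  obtain ⟨c, hc, h⟩ := hα.lower
  have := integral_mono (μ := μ) (integrable_const c) hα.integrable h
  simp at this
  linarith

/-- The logarithm lies between the constant `log c` and `α` itself. -/
theorem IsPotential.integrable_log [IsFiniteMeasure μ] (hα : IsPotential μ α) :
    Integrable (fun x => Real.log (α x)) μ := by
  obtain ⟨c, hc, h⟩ := hα.lower
  refine (hα.integrable.add (integrable_const |Real.log c|)).mono'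
    hα.measurable.log.aestronglyMeasurable (ae_of_all _ fun x => ?_)
  have h1 : Real.log (α x) ≤ α x := (Real.log_le_sub_one_of_pos (hα.pos x)).trans (by linarith)
  have h2 : Real.log c ≤ Real.log (α x) := Real.log_le_log hc (h x)
  have h3 := hα.pos x
  rw [Real.norm_eq_abs, abs_le, Pi.add_apply]
  constructor
  · linarith [neg_abs_le (Real.log c)]
  · linarith [abs_nonneg (Real.log c)]

/-- Jensen's inequality for the exponential. -/
theorem exp_integral_le_integral_exp [IsProbabilityMeasure μ] {f : X → ℝ} (hf : Integrable f μ)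
    (hef : Integrable (fun x => Real.exp (f x)) μ) :
    Real.exp (∫ x, f x ∂μ) ≤ ∫ x, Real.exp (f x) ∂μ := by
  have := convexOn_exp.map_integral_le (μ := μ) Real.continuous_exp.continuousOn isClosed_univ
    (ae_of_all _ fun _ => mem_univ _) hf hef
  exact this

theorem CostBounds.measurable_left (hW : CostBounds μ η W C D) (y : Y) :
    Measurable (fun x => W x y) :=
  hW.measurable.comp (measurable_id.prodMk measurable_const)

theorem CostBounds.integrable_exp_mul (hW : CostBounds μ η W C D) (hα : IsPotential μ α) (y : Y) :
    Integrable (fun x => Real.exp (-W x y) * α x) μ := by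
  refine (hα.integrable.const_mul C).mono'
    ((hW.measurable_left y).neg.exp.mul hα.measurable).aestronglyMeasurable
    (ae_of_all _ fun x => ?_)
  have := hα.pos x
  rw [Real.norm_of_nonneg (by positivity)]
  gcongr
  exact hW.exp_le x y

/-- Jensen applied to `log α - W(·, y)`. This makes the denominator of the update positive and
yields the upper bound on `dualPot`. -/
theorem CostBounds.exp_le_integral [IsProbabilityMeasure μ] (hW : CostBounds μ η W C D)
    (hα : IsPotential μ α) (y : Y) :
    Real.exp (∫ x, Real.log (α x) ∂μ - ∫ x, W x y ∂μ) ≤ ∫ x, Real.exp (-W x y) * α x ∂μ := by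
  have h0 : (fun x => Real.exp (Real.log (α x) - W x y)) =
      fun x => Real.exp (-W x y) * α x := by
    funext x
    rw [sub_eq_neg_add, Real.exp_add, Real.exp_log (hα.pos x)]
  have h1 := exp_integral_le_integral_exp (hα.integrable_log.sub (hW.integrable_left y))
    (by simpa only [Pi.sub_apply, h0] using hW.integrable_exp_mul hα y)
  simp only [Pi.sub_apply, h0] at h1
  rwa [integral_sub hα.integrable_log (hW.integrable_left y)] at h1

theorem CostBounds.integral_exp_mul_pos [IsProbabilityMeasure μ] (hW : CostBounds μ η W C D)
    (hα : IsPotential μ α) (y : Y) : 0 < ∫ x, Real.exp (-W x y) * α x ∂μ :=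
  (Real.exp_pos _).trans_le (hW.exp_le_integral hα y)

theorem CostBounds.dualPot_pos [IsProbabilityMeasure μ] (hW : CostBounds μ η W C D)
    (hα : IsPotential μ α) (y : Y) : 0 < dualPot μ W α y :=
  inv_pos.2 (hW.integral_exp_mul_pos hα y)

theorem CostBounds.le_dualPot [IsProbabilityMeasure μ] (hW : CostBounds μ η W C D)
    (hα : IsPotential μ α) (y : Y) : (C * ∫ x, α x ∂μ)⁻¹ ≤ dualPot μ W α y := by
  refine inv_anti₀ (hW.integral_exp_mul_pos hα y) ?_
  rw [← integral_const_mul]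
  refine integral_mono (hW.integrable_exp_mul hα y) (hα.integrable.const_mul C) fun x => ?_
  have := hα.pos x
  dsimp only
  gcongr
  exact hW.exp_le x y

theorem CostBounds.dualPot_le [IsProbabilityMeasure μ] (hW : CostBounds μ η W C D)
    (hα : IsPotential μ α) (y : Y) :
    dualPot μ W α y ≤ Real.exp (∫ x, W x y ∂μ) * Real.exp (-∫ x, Real.log (α x) ∂μ) := by
  rw [← Real.exp_add, dualPot, ← neg_neg (_ + _), Real.exp_neg (-_)]
  refine inv_anti₀ (Real.exp_pos _) ((le_of_eq ?_).trans (hW.exp_le_integral hα y))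
  congr 1
  ring

theorem CostBounds.measurable_dualPot [SFinite μ] (hW : CostBounds μ η W C D)
    (hα : IsPotential μ α) : Measurable (dualPot μ W α) := by
  have h : Measurable (Function.uncurry fun (y : Y) (x : X) => Real.exp (-W x y) * α x) :=
    (hW.measurable.comp measurable_swap).neg.exp.mul (hα.measurable.comp measurable_snd)
  exact (h.stronglyMeasurable.integral_prod_right (ν := μ)).measurable.inv

theorem CostBounds.integrable_dualPot [IsProbabilityMeasure μ] (hW : CostBounds μ η W C D)
    (hα : IsPotential μ α) : Integrable (dualPot μ W α) η := by
  refine (hW.integrable_exp_left.mul_const (Real.exp (-∫ x, Real.log (α x) ∂μ))).mono'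
    (hW.measurable_dualPot hα).aestronglyMeasurable (ae_of_all _ fun y => ?_)
  rw [Real.norm_of_nonneg (hW.dualPot_pos hα y).le]
  exact hW.dualPot_le hα y

theorem CostBounds.isPotential_dualPot [IsProbabilityMeasure μ] (hW : CostBounds μ η W C D)
    (hα : IsPotential μ α) : IsPotential η (dualPot μ W α) :=
  ⟨hW.measurable_dualPot hα, ⟨_, by
    have := hα.integral_pos
    have := hW.one_le_C
    positivity, hW.le_dualPot hα⟩, hW.integrable_dualPot hα⟩

theorem CostBounds.integral_dualPot_le [IsProbabilityMeasure μ] (hW : CostBounds μ η W C D)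
    (hα : IsPotential μ α) :
    ∫ y, dualPot μ W α y ∂η ≤ D * Real.exp (-∫ x, Real.log (α x) ∂μ) := by
  calc _ ≤ ∫ y, Real.exp (∫ x, W x y ∂μ) * Real.exp (-∫ x, Real.log (α x) ∂μ) ∂η :=
        integral_mono (hW.integrable_dualPot hα) (hW.integrable_exp_left.mul_const _)
          (hW.dualPot_le hα)
    _ ≤ _ := by
        rw [integral_mul_const]
        gcongr
        exact hW.integral_exp_left

/-- The second Sinkhorn update has a lower bound in terms of the first potential. -/
theorem CostBounds.le_dualPot_dualPot [IsProbabilityMeasure μ] [IsProbabilityMeasure η]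
    (hW : CostBounds μ η W C D) (hα : IsPotential μ α) (x : X) :
    (C * D)⁻¹ * Real.exp (∫ x, Real.log (α x) ∂μ) ≤
      dualPot η (fun y x => W x y) (dualPot μ W α) x := by
  refine le_trans ?_ (hW.swap.le_dualPot (hW.isPotential_dualPot hα) x)
  have h0 := (hW.isPotential_dualPot hα).integral_pos
  have hC := hW.one_le_C
  have hD := hW.one_le_D
  rw [← neg_neg (∫ x, Real.log (α x) ∂μ), Real.exp_neg (-_), ← mul_inv, mul_assoc]
  refine inv_anti₀ (by positivity) ?_
  gcongr
  exact hW.integral_dualPot_le hα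

/-- The dual objective does not decrease along Sinkhorn updates. -/
theorem CostBounds.integral_log_le [IsProbabilityMeasure μ] [IsProbabilityMeasure η]
    (hW : CostBounds μ η W C D) (hα : IsPotential μ α) :
    ∫ x, Real.log (α x) ∂μ ≤
      ∫ x, Real.log (dualPot η (fun y x => W x y) (dualPot μ W α) x) ∂μ := by
  set β := dualPot μ W α with hβdef
  have hβ : IsPotential η β := hW.isPotential_dualPot hα
  set α' := dualPot η (fun y x => W x y) β with hα'def
  have hα' : IsPotential μ α' := hW.swap.isPotential_dualPot hβ
  have hprod : Integrable (Function.uncurry fun (x : X) (y : Y) =>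
      α x * (Real.exp (-W x y) * β y)) (μ.prod η) := by
    refine ((hα.integrable.mul_prod hβ.integrable).const_mul C).mono' ?_
      (ae_of_all _ fun z => ?_)
    · exact ((hα.measurable.comp measurable_fst).mul
        (hW.measurable.neg.exp.mul (hβ.measurable.comp measurable_snd))).aestronglyMeasurable
    · obtain ⟨x, y⟩ := z
      have h1 := hα.pos x
      have h2 := hβ.pos y
      simp only [Function.uncurry_apply_pair]
      rw [Real.norm_of_nonneg (by positivity)]
      calc α x * (Real.exp (-W x y) * β y) = Real.exp (-W x y) * (α x * β y) := by ring
        _ ≤ _ := by gcongr; exact hW.exp_le x y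
  -- Dividing by `α'` multiplies by the integral defining it, so `α / α'` is a marginal of the
  -- density `α e^{-W} β`. That density has total mass one, because the choice of `β` normalizes it
  -- in `x` for each `y`.
  have hratio : ∀ x, α x / α' x = ∫ y, α x * (Real.exp (-W x y) * β y) ∂η := fun x => by
    rw [integral_const_mul, hα'def, dualPot, div_inv_eq_mul]
  have hone : ∫ x, α x / α' x ∂μ = 1 := by
    simp_rw [hratio]
    rw [integral_integral_swap hprod]
    have : ∀ y, ∫ x, α x * (Real.exp (-W x y) * β y) ∂μ = 1 := fun y => by
      have : ∀ x, α x * (Real.exp (-W x y) * β y) = (Real.exp (-W x y) * α x) * β y :=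
        fun x => by ring
      simp_rw [this]
      rw [integral_mul_const, hβdef, dualPot]
      exact mul_inv_cancel₀ (hW.integral_exp_mul_pos hα y).ne'
    simp [this]
  have hint : Integrable (fun x => α x / α' x) μ := by
    simp_rw [hratio]
    exact hprod.integral_prod_left
  -- Nonnegativity of relative entropy, through `log t ≤ t - 1`.
  have key : ∫ x, (Real.log (α x) - Real.log (α' x)) ∂μ ≤ ∫ x, (α x / α' x - 1) ∂μ := by
    refine integral_mono (hα.integrable_log.sub hα'.integrable_log)
      (hint.sub (integrable_const 1)) fun x => ?_
    dsimp only
    rw [← Real.log_div (hα.pos x).ne' (hα'.pos x).ne']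
    exact Real.log_le_sub_one_of_pos (div_pos (hα.pos x) (hα'.pos x))
  rw [integral_sub hα.integrable_log hα'.integrable_log,
    integral_sub hint (integrable_const 1), hone] at key
  simp at key
  exact key

end Potentials

/-! ### The invariant along the iteration and the bounds on products of consecutive potentials. -/

/-- The invariant of a Sinkhorn half step: `β` is the update of `α`, the dual objective is bounded
below, and `β` is bounded below in terms of the previous value of the dual potential. -/
structure SinkhornPair {X Y : Type*} [MeasurableSpace X] [MeasurableSpace Y] (μ : Measure X)
    (η : Measure Y) (W : X → Y → ℝ) (C D : ℝ) (α : X → ℝ) (β : Y → ℝ) : Prop where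
  isPotential : IsPotential μ α
  eq_dualPot : β = dualPot μ W α
  dual_ge : -Real.log C ≤ ∫ x, Real.log (α x) ∂μ + ∫ y, Real.log (β y) ∂η
  lower : ∃ m : ℝ, -Real.log C ≤ m + ∫ x, Real.log (α x) ∂μ ∧
    ∀ y, (C * D)⁻¹ * Real.exp m ≤ β y

section Pairs

variable {X Y : Type*} [MeasurableSpace X] [MeasurableSpace Y] {μ : Measure X} {η : Measure Y}
  {W : X → Y → ℝ} {C D : ℝ} {α : X → ℝ} {β : Y → ℝ}

theorem CostBounds.sinkhornPair_one [IsProbabilityMeasure μ] [IsProbabilityMeasure η]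
    (hW : CostBounds μ η W C D) :
    SinkhornPair μ η W C D (fun _ => 1) (dualPot μ W fun _ => 1) := by
  have h1 : IsPotential μ (fun _ => (1 : ℝ)) :=
    ⟨measurable_const, ⟨1, one_pos, fun _ => le_rfl⟩, integrable_const 1⟩
  have hC := hW.one_le_C
  have hD := hW.one_le_D
  have hlow : ∀ y, C⁻¹ ≤ dualPot μ W (fun _ => 1) y := fun y => by
    simpa using hW.le_dualPot h1 y
  have hlog := (hW.isPotential_dualPot h1).integrable_log
  -- No earlier potential exists at the start; `m = 0` plays the role of its log-integral.
  refine ⟨h1, rfl, ?_, 0, ?_, fun y => le_trans ?_ (hlow y)⟩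
  · have : ∫ _ : Y, -Real.log C ∂η ≤ ∫ y, Real.log (dualPot μ W (fun _ => 1) y) ∂η := by
      refine integral_mono (integrable_const _) hlog fun y => ?_
      dsimp only
      rw [← Real.log_inv]
      exact Real.log_le_log (by positivity) (hlow y)
    simpa using this
  · simpa using Real.log_nonneg hC
  · rw [Real.exp_zero, mul_one]
    refine inv_anti₀ (by positivity) ?_
    nlinarith

theorem SinkhornPair.next [IsProbabilityMeasure μ] [IsProbabilityMeasure η]
    (hW : CostBounds μ η W C D) (h : SinkhornPair μ η W C D α β) :
    SinkhornPair η μ (fun y x => W x y) C D β (dualPot η (fun y x => W x y) β) := by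
  obtain ⟨hα, rfl, hdual, -⟩ := h
  have h2 := hW.integral_log_le hα
  -- The new `m` is `∫ log α dμ`, so the condition on `m` is exactly the old bound on the objective.
  exact ⟨hW.isPotential_dualPot hα, rfl, by linarith, _, hdual, hW.le_dualPot_dualPot hα⟩

theorem SinkhornPair.le_mul_next [IsProbabilityMeasure μ] [IsProbabilityMeasure η]
    (hW : CostBounds μ η W C D) (h : SinkhornPair μ η W C D α β) (x : X) (y : Y) :
    ((C * D) ^ 2 * C)⁻¹ ≤ β y * dualPot η (fun y x => W x y) β x := by
  obtain ⟨hα, rfl, hdual, m, hm, hlow⟩ := h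
  have hC := hW.one_le_C
  have hD := hW.one_le_D
  calc ((C * D) ^ 2 * C)⁻¹ = (C * D)⁻¹ * (C * D)⁻¹ * Real.exp (-Real.log C) := by
        rw [Real.exp_neg, Real.exp_log (by positivity)]
        field_simp
    _ ≤ (C * D)⁻¹ * (C * D)⁻¹ * Real.exp (m + ∫ x, Real.log (α x) ∂μ) := by gcongr
    _ = ((C * D)⁻¹ * Real.exp m) * ((C * D)⁻¹ * Real.exp (∫ x, Real.log (α x) ∂μ)) := by
        rw [Real.exp_add]; ring
    _ ≤ _ := mul_le_mul (hlow y) (hW.le_dualPot_dualPot hα x) (by positivity)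
        (hW.dualPot_pos hα y).le

theorem SinkhornPair.mul_next_le [IsProbabilityMeasure μ] [IsProbabilityMeasure η]
    (hW : CostBounds μ η W C D) (h : SinkhornPair μ η W C D α β) (x : X) (y : Y) :
    β y * dualPot η (fun y x => W x y) β x ≤
      C * (Real.exp (∫ x, W x y ∂μ) * Real.exp (∫ y, W x y ∂η)) := by
  obtain ⟨hα, rfl, hdual, -⟩ := h
  have hC := hW.one_le_C
  have hβ := hW.isPotential_dualPot hα
  have hexp : Real.exp (-∫ x, Real.log (α x) ∂μ) *
      Real.exp (-∫ y, Real.log (dualPot μ W α y) ∂η) ≤ C := by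
    rw [← Real.exp_add]
    refine (Real.exp_le_exp.2 ?_).trans (Real.exp_log (by positivity : 0 < C)).le
    linarith
  calc _ ≤ (Real.exp (∫ x, W x y ∂μ) * Real.exp (-∫ x, Real.log (α x) ∂μ)) *
        (Real.exp (∫ y, W x y ∂η) * Real.exp (-∫ y, Real.log (dualPot μ W α y) ∂η)) :=
        mul_le_mul (hW.dualPot_le hα y) (hW.swap.dualPot_le hβ x)
          (hW.swap.dualPot_pos hβ x).le (by positivity)
    _ = (Real.exp (-∫ x, Real.log (α x) ∂μ) *
        Real.exp (-∫ y, Real.log (dualPot μ W α y) ∂η)) *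
        (Real.exp (∫ x, W x y ∂μ) * Real.exp (∫ y, W x y ∂η)) := by ring
    _ ≤ _ := by gcongr

end Pairs


/-! ### Weighted total variation contraction from drift and minorization. -/

section Contraction

variable {X Y : Type*} [MeasurableSpace X] [MeasurableSpace Y]

theorem add_sub_eq_add_sub (μ₁ μ₂ : Measure X) [IsFiniteMeasure μ₁] [IsFiniteMeasure μ₂] :
    μ₁ + (μ₂ - μ₁) = μ₂ + (μ₁ - μ₂) := by
  rw [← Measure.toSignedMeasure_eq_toSignedMeasure_iff, Measure.toSignedMeasure_add,
    Measure.toSignedMeasure_add]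
  have := Measure.sub_toSignedMeasure_eq_toSignedMeasure_sub (μ := μ₁) (ν := μ₂)
  rw [sub_eq_sub_iff_add_eq_add] at this
  rw [this, add_comm]

/-- Minimality of the Jordan decomposition: if `μ₁ - μ₂ = A - B`, the positive and negative parts
lie below `A` and `B`. -/
theorem weightedTV_le_of_add_eq (h : X → ℝ) {μ₁ μ₂ A B : Measure X}
    (hAB : μ₁ + B = μ₂ + A) :
    weightedTV h μ₁ μ₂ ≤ ∫⁻ x, ENNReal.ofReal (h x) ∂A + ∫⁻ x, ENNReal.ofReal (h x) ∂B := by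
  rw [weightedTV, lintegral_add_measure]
  refine add_le_add (lintegral_mono' ?_ le_rfl) (lintegral_mono' ?_ le_rfl)
  · exact Measure.sub_le_of_le_add (by rw [add_comm A, ← hAB]; exact Measure.le_add_right le_rfl)
  · exact Measure.sub_le_of_le_add (by rw [add_comm B, hAB]; exact Measure.le_add_right le_rfl)

theorem bind_add_left (μ₁ μ₂ : Measure X) (K : Kernel X Y) :
    (μ₁ + μ₂).bind K = μ₁.bind K + μ₂.bind K := by
  ext s hs
  rw [Measure.bind_apply hs K.aemeasurable, Measure.add_apply, Measure.bind_apply hs K.aemeasurable,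
    Measure.bind_apply hs K.aemeasurable, lintegral_add_measure]

theorem bind_apply_univ (μ : Measure X) (K : Kernel X Y) [IsMarkovKernel K] :
    μ.bind K univ = μ univ := by
  rw [Measure.bind_apply .univ K.aemeasurable]
  simp

/-- A minorization of a kernel on a set gives a minorization of its action on measures. -/
theorem smul_le_bind {K : Kernel X Y} {ν₀ : Measure Y} {S : Set X} (hS : MeasurableSet S)
    (hK : ∀ x ∈ S, ν₀ ≤ K x) (p : Measure X) {s : ℝ≥0∞} (hs : s ≤ p S) :
    s • ν₀ ≤ p.bind K := by
  refine Measure.le_iff.2 fun E hE => ?_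
  rw [Measure.bind_apply hE K.aemeasurable, Measure.smul_apply, smul_eq_mul]
  calc s * ν₀ E ≤ p S * ν₀ E := by gcongr
    _ = ∫⁻ _ in S, ν₀ E ∂p := by rw [setLIntegral_const, mul_comm]
    _ ≤ ∫⁻ x in S, K x E ∂p := setLIntegral_mono' hS fun x hx => hK x hx E
    _ ≤ ∫⁻ x, K x E ∂p := setLIntegral_le_lintegral _ _

/-- Mass of the image of `p`, after removing a common part, in the weighted norm. -/
theorem lintegral_residual_le {K : Kernel X Y} [IsMarkovKernel K] {g : X → ℝ} {h : Y → ℝ}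
    (hg0 : ∀ x, 0 < g x) (hh : Measurable h) (hh0 : ∀ y, 0 < h y) {c a : ℝ} (hc : 0 ≤ c)
    (ha : 0 < a) (hdrift : ∀ x, ∫⁻ y, ENNReal.ofReal (h y) ∂(K x) ≤ ENNReal.ofReal (g x / 4 + c))
    (p : Measure X) [IsFiniteMeasure p] (hgp : Integrable g p) (R : Measure Y) [IsFiniteMeasure R]
    (hR : R ≤ p.bind K) :
    ∫⁻ y, ENNReal.ofReal (1 / 2 + a * h y) ∂(p.bind K - R) ≤
      ENNReal.ofReal (1 / 2 * (p.real univ - R.real univ) +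
        a * ((∫ x, g x ∂p) / 4 + c * p.real univ)) := by
  have hmass : (p.bind K - R) univ = ENNReal.ofReal (p.real univ - R.real univ) := by
    rw [Measure.sub_apply .univ hR, bind_apply_univ, ENNReal.ofReal_sub _ measureReal_nonneg,
      ofReal_measureReal, ofReal_measureReal]
  have hle : R.real univ ≤ p.real univ := by
    have := hR univ
    rw [bind_apply_univ] at this
    exact ENNReal.toReal_mono (measure_ne_top _ _) this
  -- Removing `R` is not exploited in the `h` part, which only needs the drift; the gain is in the
  -- constant part `1/2` of the weight.
  have hh1 : ∫⁻ y, ENNReal.ofReal (h y) ∂(p.bind K - R) ≤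
      ENNReal.ofReal ((∫ x, g x ∂p) / 4 + c * p.real univ) := by
    calc _ ≤ ∫⁻ y, ENNReal.ofReal (h y) ∂(p.bind K) := lintegral_mono' Measure.sub_le le_rfl
      _ = ∫⁻ x, ∫⁻ y, ENNReal.ofReal (h y) ∂(K x) ∂p :=
        Measure.lintegral_bind K.aemeasurable hh.ennreal_ofReal.aemeasurable
      _ ≤ ∫⁻ x, ENNReal.ofReal (g x / 4 + c) ∂p := lintegral_mono hdrift
      _ = ENNReal.ofReal (∫ x, (g x / 4 + c) ∂p) :=
        (ofReal_integral_eq_lintegral_ofReal ((hgp.div_const 4).add (integrable_const c))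
          (ae_of_all _ fun x => add_nonneg (div_nonneg (hg0 x).le (by norm_num)) hc)).symm
      _ = _ := by
        rw [integral_add (hgp.div_const 4) (integrable_const c), integral_div, integral_const,
          smul_eq_mul, mul_comm c]
  have hsplit : ∀ y, ENNReal.ofReal (1 / 2 + a * h y) =
      ENNReal.ofReal (1 / 2) + ENNReal.ofReal a * ENNReal.ofReal (h y) := fun y => by
    rw [ENNReal.ofReal_add (by norm_num) (mul_pos ha (hh0 y)).le, ENNReal.ofReal_mul ha.le]
  simp_rw [hsplit]
  have hI : 0 ≤ ∫ x, g x ∂p := integral_nonneg fun x => (hg0 x).le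
  rw [lintegral_add_left measurable_const, lintegral_const, hmass,
    lintegral_const_mul _ hh.ennreal_ofReal, ENNReal.ofReal_add, ENNReal.ofReal_mul (by norm_num),
    ENNReal.ofReal_mul ha.le]
  · gcongr
  · have := sub_nonneg.2 hle
    positivity
  · have := measureReal_nonneg (μ := p) (s := univ)
    positivity

/-- Numerical inequality behind the weighted contraction. -/
theorem contraction_arith {m s κ T a b c : ℝ} (hm : 0 ≤ m) (hs : 0 ≤ s) (hc : 0 ≤ c)
    (hb : 0 < b) (hb1 : b ≤ 1) (hκ : b ≤ κ) (ha : a = b / (8 * c + 8)) (hT : 0 ≤ T)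
    (hcase : m / 2 ≤ s ∨ (8 * c + 4) * m ≤ T) :
    m - s * κ + a * (T / 4 + 2 * (c * m)) ≤ (1 - a) * (m + a * T) := by
  have ha0 : 0 < a := by rw [ha]; positivity
  have hab : a * (8 * c + 8) = b := by rw [ha]; field_simp
  have ha8 : a ≤ 1 / 8 := by nlinarith
  -- In the first case the removed mass is at least `m b / 2 = m a (4c + 4)`, which pays for the
  -- drift constant `2acm` and the loss `am`. In the second case `T` is so large that the factor
  -- `1/4` in the drift suffices without any removal.
  rcases hcase with h | h
  · have h1 : m / 2 * b ≤ s * κ := mul_le_mul h hκ hb.le hs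
    have h2 : 0 ≤ a * T := by positivity
    have h3 : a * (a * T) ≤ 1 / 8 * (a * T) := by gcongr
    have h4 : m / 2 * b = m * a * (4 * c + 4) := by rw [← hab]; ring
    have h5 : 0 ≤ m * a := by positivity
    have h6 : 0 ≤ m * a * c := by positivity
    linarith
  · have h1 : 0 ≤ s * κ := mul_nonneg hs (hb.le.trans hκ)
    have h2 : a * ((8 * c + 4) * m) ≤ a * T := by gcongr
    have h2' : 0 ≤ a * T := by positivity
    have h3 : a * (a * T) ≤ 1 / 8 * (a * T) := by gcongr
    have h5 : 0 ≤ m * a := by positivity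
    have h6 : 0 ≤ m * a * c := by positivity
    linarith

theorem mul_sub_le_integral {g : X → ℝ} (hg0 : ∀ x, 0 < g x) (hg : Measurable g)
    (p : Measure X) [IsFiniteMeasure p] (hgp : Integrable g p) {r : ℝ} (hr : 0 ≤ r) :
    r * (p.real univ - p.real {x | g x ≤ r}) ≤ ∫ x, g x ∂p := by
  have h1 := mul_meas_ge_le_integral_of_nonneg (ae_of_all p fun x => (hg0 x).le) hgp r
  refine le_trans ?_ h1
  gcongr
  rw [← measureReal_compl (measurableSet_le hg measurable_const)]
  refine measureReal_mono fun x hx => ?_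
  have hx' : ¬ g x ≤ r := hx
  exact (not_le.1 hx').le

/-- Contraction in weighted total variation from a drift condition and a minorization on a
sub-level set of the weight. -/
theorem lip_le_of_drift_of_minorization {K : Kernel X Y} [IsMarkovKernel K] {g : X → ℝ}
    {h : Y → ℝ} (hg : Measurable g) (hg0 : ∀ x, 0 < g x) (hh : Measurable h)
    (hh0 : ∀ y, 0 < h y) {b c : ℝ} (hc : 0 ≤ c) (hb : 0 < b) (hb1 : b ≤ 1)
    (hdrift : ∀ x, ∫⁻ y, ENNReal.ofReal (h y) ∂(K x) ≤ ENNReal.ofReal (g x / 4 + c))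
    (ν₀ : Measure Y) [IsFiniteMeasure ν₀] (hν₀ : b ≤ ν₀.real univ)
    (hminor : ∀ x, g x ≤ 16 * c + 8 → ν₀ ≤ K x) :
    lip (fun x => 1 / 2 + b / (8 * c + 8) * g x) (fun y => 1 / 2 + b / (8 * c + 8) * h y) K ≤
      ENNReal.ofReal (1 - b / (8 * c + 8)) := by
  set a := b / (8 * c + 8) with ha
  have ha0 : 0 < a := by positivity
  have ha1 : a ≤ 1 := by
    rw [ha, div_le_one (by positivity)]
    linarith
  refine iSup_le fun μ₁ => iSup_le fun μ₂ => iSup_le fun _ => iSup_le fun _ => iSup_le fun h1 =>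
    iSup_le fun h2 => iSup_le fun _ => ENNReal.div_le_of_le_mul ?_
  have hint : ∀ μ : Measure X, [IsFiniteMeasure μ] →
      ∫⁻ x, ENNReal.ofReal (1 / 2 + a * g x) ∂μ < ∞ → Integrable g μ := fun μ _ hμ => by
    have h3 : Integrable (fun x => 1 / 2 + a * g x) μ := by
      refine ⟨(measurable_const.add (hg.const_mul a)).aestronglyMeasurable, ?_⟩
      rw [hasFiniteIntegral_iff_ofReal (ae_of_all _ fun x => by
        have := hg0 x; dsimp only [Pi.zero_apply]; positivity)]
      exact hμ
    have h4 := (h3.sub (integrable_const (1 / 2))).const_mul a⁻¹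
    refine h4.congr (ae_of_all _ fun x => ?_)
    simp only [Pi.sub_apply]
    field_simp
    ring
  set p := μ₁ - μ₂ with hp
  set q := μ₂ - μ₁ with hq
  have hgp : Integrable g p := (hint μ₁ h1).mono_measure Measure.sub_le
  have hgq : Integrable g q := (hint μ₂ h2).mono_measure Measure.sub_le
  have hadd : μ₁ + q = μ₂ + p := add_sub_eq_add_sub μ₁ μ₂
  -- Equality of the two masses uses that both measures are probabilities.
  have hpq : p univ = q univ := by
    have := congrArg (fun μ : Measure X => μ univ) hadd
    simp only [Measure.add_apply, measure_univ] at this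
    exact ((ENNReal.add_right_inj ENNReal.one_ne_top).1 this).symm
  have hpqR : q.real univ = p.real univ := by rw [measureReal_def, measureReal_def, hpq]
  set S := {x | g x ≤ 16 * c + 8} with hS
  have hSm : MeasurableSet S := measurableSet_le hg measurable_const
  set s := min (p S) (q S) with hs
  have hsfin : s ≠ ∞ := ((min_le_left _ _).trans_lt (measure_lt_top p S)).ne
  have : IsFiniteMeasure (s • ν₀) := Measure.smul_finite ν₀ hsfin
  have hRp : s • ν₀ ≤ p.bind K := smul_le_bind hSm hminor p (min_le_left _ _)
  have hRq : s • ν₀ ≤ q.bind K := smul_le_bind hSm hminor q (min_le_right _ _)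
  -- The common part `s • ν₀` of the two images cancels in the difference, leaving a decomposition
  -- with less mass.
  have hAB : μ₁.bind K + (q.bind K - s • ν₀) = μ₂.bind K + (p.bind K - s • ν₀) := by
    rw [← Measure.add_left_inj (s • ν₀), add_assoc, add_assoc,
      Measure.sub_add_cancel_of_le hRp, Measure.sub_add_cancel_of_le hRq, ← bind_add_left,
      ← bind_add_left, hadd]
  have hsR : s.toReal = min (p.real S) (q.real S) :=
    ENNReal.toReal_min (measure_ne_top _ _) (measure_ne_top _ _)
  have hmass : (s • ν₀).real univ = s.toReal * ν₀.real univ := by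
    simp [measureReal_def, ENNReal.toReal_mul]
  have hP : 0 ≤ ∫ x, g x ∂p := integral_nonneg fun x => (hg0 x).le
  have hQ : 0 ≤ ∫ x, g x ∂q := integral_nonneg fun x => (hg0 x).le
  -- If `p` or `q` puts less than half its mass on `S`, Markov's inequality at level `16c + 8` makes
  -- the integral of `g` at least half that level times the mass.
  have hcase : p.real univ / 2 ≤ s.toReal ∨
      (8 * c + 4) * p.real univ ≤ ∫ x, g x ∂p + ∫ x, g x ∂q := by
    by_contra! hcon
    obtain ⟨hc1, hc2⟩ := hcon
    have hr : (0 : ℝ) ≤ 16 * c + 8 := by positivity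
    have hp1 := mul_sub_le_integral hg0 hg p hgp hr
    have hq1 := mul_sub_le_integral hg0 hg q hgq hr
    rw [hpqR] at hq1
    rw [hsR, min_lt_iff] at hc1
    rcases hc1 with hc1 | hc1
    · have : (16 * c + 8) * (p.real univ / 2) ≤
          (16 * c + 8) * (p.real univ - p.real S) := by gcongr; linarith
      linarith
    · have : (16 * c + 8) * (p.real univ / 2) ≤
          (16 * c + 8) * (p.real univ - q.real S) := by gcongr; linarith
      linarith
  have hTV : weightedTV (fun x => 1 / 2 + a * g x) μ₁ μ₂ =
      ENNReal.ofReal (p.real univ + a * (∫ x, g x ∂p + ∫ x, g x ∂q)) := by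
    have hgi : Integrable g (p + q) := hgp.add_measure hgq
    have hgi' : Integrable (fun x => 1 / 2 + a * g x) (p + q) :=
      (integrable_const _).add (hgi.const_mul a)
    rw [weightedTV, ← hp, ← hq, ← ofReal_integral_eq_lintegral_ofReal hgi' (ae_of_all _ fun x =>
        add_nonneg (by norm_num) (mul_pos ha0 (hg0 x)).le),
      integral_add (integrable_const _) (hgi.const_mul a), integral_const_mul,
      integral_add_measure hgp hgq, integral_const, measureReal_add_apply, hpqR, smul_eq_mul]
    congr 1
    ring
  refine (weightedTV_le_of_add_eq _ hAB).trans ?_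
  refine (add_le_add
    (lintegral_residual_le hg0 hh hh0 hc ha0 hdrift p hgp _ hRp)
    (lintegral_residual_le hg0 hh hh0 hc ha0 hdrift q hgq _ hRq)).trans ?_
  rw [hTV, ← ENNReal.ofReal_mul (by linarith), hpqR, hmass]
  have hle : s.toReal * ν₀.real univ ≤ p.real univ := by
    rw [← hmass]
    have := hRp univ
    rw [bind_apply_univ] at this
    exact ENNReal.toReal_mono (measure_ne_top _ _) this
  have hm := measureReal_nonneg (μ := p) (s := univ)
  have hsub := sub_nonneg.2 hle
  rw [← ENNReal.ofReal_add (by positivity) (by positivity)]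
  refine ENNReal.ofReal_le_ofReal (le_trans (le_of_eq ?_)
    (contraction_arith hm ENNReal.toReal_nonneg hc hb hb1 hν₀ ha (add_nonneg hP hQ) hcase))
  ring

end Contraction


/-! ### Local boundedness, compact sub-level sets and the drift inequality. -/

section Topological

variable {Z : Type*} [TopologicalSpace Z]

theorem LocallyBdd.exists_bound {f : Z → ℝ} (hf : LocallyBdd f) {K : Set Z} (hK : IsCompact K) :
    ∃ M : ℝ, ∀ z ∈ K, |f z| ≤ M := by
  refine hK.induction_on (p := fun s => ∃ M : ℝ, ∀ z ∈ s, |f z| ≤ M) ⟨0, by simp⟩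
    (fun s t hst ⟨M, hM⟩ => ⟨M, fun z hz => hM z (hst hz)⟩) ?_ ?_
  · rintro s t ⟨M, hM⟩ ⟨M', hM'⟩
    refine ⟨max M M', fun z hz => hz.elim (fun h => (hM z h).trans (le_max_left _ _))
      fun h => (hM' z h).trans (le_max_right _ _)⟩
  · intro z _
    obtain ⟨N, hN, M, hM⟩ := hf z
    exact ⟨N, mem_nhdsWithin_of_mem_nhds hN, M, hM⟩

theorem measurable_of_isCompact_sublevel [T2Space Z] [MeasurableSpace Z] [BorelSpace Z]
    {U : Z → ℝ} (hU : ∀ r : ℝ, IsCompact {z | U z ≤ r}) : Measurable U :=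
  measurable_of_Iic fun r => (hU r).isClosed.measurableSet

theorem MemBZero.exists_bound {θ : Z → ℝ} (hθ : MemBZero θ) : ∃ T : ℝ, 0 < T ∧ ∀ z, θ z ≤ T := by
  obtain ⟨hpos, -, ⟨c, hc, hle⟩, -⟩ := hθ
  refine ⟨1 / c, by positivity, fun z => ?_⟩
  exact (le_one_div hc (hpos z)).1 (hle z)

/-- A function dominated by `θ e^{δU}`, with `θ` vanishing at infinity, satisfies a drift bound. -/
theorem MemBZero.exists_drift {θ : Z → ℝ} (hθ : MemBZero θ) {U : Z → ℝ} (hU : LocallyBdd U)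
    {δ : ℝ} (hδ : 0 < δ) {B : ℝ} (hB : 0 < B) :
    ∃ c : ℝ, 0 ≤ c ∧ ∀ z, B * (θ z * Real.exp (δ * U z)) ≤ Real.exp (δ * U z) / 4 + c := by
  obtain ⟨T, hT, hθT⟩ := hθ.exists_bound
  obtain ⟨M, hM⟩ := hU.exists_bound (hθ.2.2.2 (4 * B))
  refine ⟨B * (T * Real.exp (δ * M)), by positivity, fun z => ?_⟩
  have hz0 := hθ.1 z
  -- On this compact set `U` and `θ` are bounded, which gives the constant `c`; off it `B θ < 1/4`.
  by_cases hz : 1 / θ z ≤ 4 * B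
  · have h1 : U z ≤ M := (le_abs_self _).trans (hM z hz)
    have h2 : B * (θ z * Real.exp (δ * U z)) ≤ B * (T * Real.exp (δ * M)) := by
      gcongr
      exact hθT z
    have := Real.exp_pos (δ * U z)
    linarith
  · have h1 : B * θ z ≤ 1 / 4 := by
      rw [not_le, lt_div_iff₀ hz0] at hz
      linarith
    have h2 : 0 ≤ B * (T * Real.exp (δ * M)) := by positivity
    calc B * (θ z * Real.exp (δ * U z)) = (B * θ z) * Real.exp (δ * U z) := by ring
      _ ≤ 1 / 4 * Real.exp (δ * U z) := by gcongr
      _ ≤ _ := by linarith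

end Topological

/-! ### Integration against Gibbs measures. -/

section Gibbs

variable {Z : Type*} [MeasurableSpace Z] {lam : Measure Z} {U : Z → ℝ}

theorem lintegral_gibbs (hU : Measurable U) {F : Z → ℝ≥0∞} (hF : Measurable F) :
    ∫⁻ z, F z ∂(gibbs lam U) = ∫⁻ z, ENNReal.ofReal (Real.exp (-U z)) * F z ∂lam :=
  lintegral_withDensity_eq_lintegral_mul _ hU.neg.exp.ennreal_ofReal hF

/-- Against the Gibbs weight, `e^{2δU} e^{-U} = e^{-(1-2δ)U}`, whose integral is assumed finite. -/
theorem integrable_exp_two_mul (hU : Measurable U) {δ : ℝ}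
    (h : gibbs lam (fun z => (1 - 2 * δ) * U z) univ < ∞) :
    Integrable (fun z => Real.exp (2 * δ * U z)) (gibbs lam U) := by
  refine ⟨(hU.const_mul _).exp.aestronglyMeasurable, ?_⟩
  rw [hasFiniteIntegral_iff_ofReal (ae_of_all _ fun z => (Real.exp_pos _).le),
    lintegral_gibbs hU (hU.const_mul _).exp.ennreal_ofReal]
  rw [← lintegral_one, lintegral_gibbs (hU.const_mul _) measurable_const] at h
  refine lt_of_le_of_lt (lintegral_mono fun z => le_of_eq ?_) h
  rw [← ENNReal.ofReal_mul (Real.exp_pos _).le, ← Real.exp_add, mul_one]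
  congr 2
  ring

end Gibbs

/-! ### From potentials to transition kernels. -/

section Densities

variable {X Y : Type*} [MeasurableSpace X] [MeasurableSpace Y]

theorem CostBounds.lintegral_ofReal_mul {μ : Measure X} {η : Measure Y} {W : X → Y → ℝ}
    {C D : ℝ} {α : X → ℝ} (hW : CostBounds μ η W C D) (hα : IsPotential μ α) {b : ℝ} (hb : 0 ≤ b)
    (y : Y) :
    ∫⁻ x, ENNReal.ofReal (b * Real.exp (-W x y) * α x) ∂μ =
      ENNReal.ofReal (b * (dualPot μ W α y)⁻¹) := by
  have hp := hα.pos
  simp_rw [mul_assoc b]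
  rw [← ofReal_integral_eq_lintegral_ofReal ((hW.integrable_exp_mul hα y).const_mul b)
    (ae_of_all _ fun x => mul_nonneg hb (mul_pos (Real.exp_pos _) (hp x)).le),
    integral_const_mul, dualPot, inv_inv]

/-- Bayes' rule for densities in product form is the update of the potential. -/
theorem bayesDual_eq {lam : Measure X} {U : X → ℝ} (hU : Measurable U)
    [IsProbabilityMeasure (gibbs lam U)] {η : Measure Y} {W : X → Y → ℝ} {C D : ℝ} {α : X → ℝ}
    (hW : CostBounds (gibbs lam U) η W C D) (hα : IsPotential (gibbs lam U) α) {b : Y → ℝ}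
    (hb : ∀ y, 0 < b y) {k : X → Y → ℝ≥0∞}
    (hk : ∀ x y, k x y = ENNReal.ofReal (b y * Real.exp (-W x y) * α x)) (y : Y) (x : X) :
    bayesDual lam U k y x =
      ENNReal.ofReal (Real.exp (-U x) * α x * Real.exp (-W x y) * dualPot (gibbs lam U) W α y) := by
  have hm : Measurable fun x => ENNReal.ofReal (b y * Real.exp (-W x y) * α x) :=
    (((hW.measurable_left y).neg.exp.const_mul _).mul hα.measurable).ennreal_ofReal
  have hd := hW.dualPot_pos hα y
  simp only [bayesDual, hk]
  -- The factor `b y` is constant in the integration variable, so it cancels between numerator and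
  -- denominator.
  rw [← lintegral_gibbs hU hm, hW.lintegral_ofReal_mul hα (hb y).le,
    ← ENNReal.ofReal_mul (Real.exp_pos _).le,
    ← ENNReal.ofReal_div_of_pos (mul_pos (hb y) (inv_pos.2 hd))]
  congr 1
  have := (hb y).ne'
  field_simp

theorem kernel_lintegral {nu : Measure Y} [SFinite nu] {V : Y → ℝ} (hV : Measurable V)
    {k : X → Y → ℝ≥0∞} {F : X → Y → ℝ} (hF : Measurable (Function.uncurry F))
    (hk : ∀ x y, k x y = ENNReal.ofReal (Real.exp (-V y) * F x y)) (x : X) {G : Y → ℝ≥0∞}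
    (hG : Measurable G) :
    ∫⁻ y, G y ∂((Kernel.const X nu).withDensity k x) =
      ∫⁻ y, ENNReal.ofReal (F x y) * G y ∂(gibbs nu V) := by
  have hkm : Measurable (Function.uncurry k) := by
    have : Function.uncurry k = fun z : X × Y =>
        ENNReal.ofReal (Real.exp (-V z.2) * Function.uncurry F z) := by
      ext ⟨x, y⟩
      exact hk x y
    rw [this]
    exact ((hV.comp measurable_snd).neg.exp.mul hF).ennreal_ofReal
  have hFx : Measurable (F x) := hF.of_uncurry_left
  rw [Kernel.lintegral_withDensity _ hkm _ hG, Kernel.const_apply,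
    lintegral_gibbs hV (F := fun y => ENNReal.ofReal (F x y) * G y) (hFx.ennreal_ofReal.mul hG)]
  refine lintegral_congr fun y => ?_
  rw [hk, ENNReal.ofReal_mul (Real.exp_pos _).le, mul_assoc]

/-- Bounds for a Markov transition that are uniform along the Sinkhorn iteration. -/
structure TransitionBounds (η : Measure Y) (W : X → Y → ℝ) (h : Y → ℝ) (ϖ : X → ℝ) (κ B : ℝ)
    (K : Kernel X Y) : Prop where
  isMarkovKernel : IsMarkovKernel K
  drift : ∀ x, ∫⁻ y, ENNReal.ofReal (h y) ∂(K x) ≤ ENNReal.ofReal (B * Real.exp (ϖ x))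
  minor : ∀ x, η.withDensity (fun y => ENNReal.ofReal (κ * Real.exp (-W x y))) ≤ K x

variable {nu : Measure Y} [SFinite nu] {V : Y → ℝ} {μ : Measure X} {W : X → Y → ℝ} {C D : ℝ}
  {α : X → ℝ} {β : Y → ℝ} {k : X → Y → ℝ≥0∞}

/-- Normalization is built into the last potential: `α x` is the inverse of the integral it
multiplies. -/
theorem isMarkovKernel_of_density (hV : Measurable V) [IsProbabilityMeasure (gibbs nu V)]
    (hW : CostBounds μ (gibbs nu V) W C D) (hβ : IsPotential (gibbs nu V) β)
    (hα : α = dualPot (gibbs nu V) (fun y x => W x y) β)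
    (hk : ∀ x y, k x y = ENNReal.ofReal (Real.exp (-V y) * β y * Real.exp (-W x y) * α x)) :
    IsMarkovKernel ((Kernel.const X nu).withDensity k) := by
  subst hα
  have hαm := hW.swap.measurable_dualPot hβ
  have hF : Measurable (Function.uncurry fun x y =>
      β y * Real.exp (-W x y) * dualPot (gibbs nu V) (fun y x => W x y) β x) :=
    ((hβ.measurable.comp measurable_snd).mul hW.measurable.neg.exp).mul
      (hαm.comp measurable_fst)
  refine ⟨fun x => ⟨?_⟩⟩
  rw [← lintegral_one, kernel_lintegral hV hF (fun x y => by rw [hk]; congr 1; ring) x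
    measurable_const]
  have hpos := hW.swap.dualPot_pos hβ x
  have := hW.swap.lintegral_ofReal_mul hβ hpos.le x
  rw [mul_inv_cancel₀ hpos.ne', ENNReal.ofReal_one] at this
  refine Eq.trans (lintegral_congr fun y => ?_) this
  rw [mul_one]
  congr 1
  ring

theorem transitionBounds_of_density (hV : Measurable V) [IsProbabilityMeasure (gibbs nu V)]
    (hW : CostBounds μ (gibbs nu V) W C D) (hβ : IsPotential (gibbs nu V) β)
    (hα : α = dualPot (gibbs nu V) (fun y x => W x y) β)
    (hk : ∀ x y, k x y = ENNReal.ofReal (Real.exp (-V y) * β y * Real.exp (-W x y) * α x))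
    {κ : ℝ} (hlow : ∀ x y, κ ≤ β y * α x)
    (hup : ∀ x y, β y * α x ≤ C * (Real.exp (∫ x, W x y ∂μ) *
      Real.exp (∫ y, W x y ∂(gibbs nu V)))) {h : Y → ℝ} (hh : Measurable h) (hh0 : ∀ y, 0 < h y)
    {H : ℝ}
    (hH : ∫⁻ y, ENNReal.ofReal (Real.exp (∫ x, W x y ∂μ) * h y) ∂(gibbs nu V) ≤
      ENNReal.ofReal H) :
    TransitionBounds (gibbs nu V) W h (fun x => ∫ y, W x y ∂(gibbs nu V)) κ (C * C * H)
      ((Kernel.const X nu).withDensity k) := by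
  have hαm : Measurable α := hα ▸ hW.swap.measurable_dualPot hβ
  have hC := hW.one_le_C
  have hF : Measurable (Function.uncurry fun x y => β y * Real.exp (-W x y) * α x) :=
    ((hβ.measurable.comp measurable_snd).mul hW.measurable.neg.exp).mul
      (hαm.comp measurable_fst)
  have hk' : ∀ x y, k x y = ENNReal.ofReal (Real.exp (-V y) * (β y * Real.exp (-W x y) * α x)) :=
    fun x y => by rw [hk]; congr 1; ring
  refine ⟨isMarkovKernel_of_density hV hW hβ hα hk, fun x => ?_, fun x => ?_⟩
  · rw [kernel_lintegral hV hF hk' x hh.ennreal_ofReal]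
    have hexp := Real.exp_pos (∫ y, W x y ∂(gibbs nu V))
    calc _ ≤ ∫⁻ y, ENNReal.ofReal (C * C * Real.exp (∫ y, W x y ∂(gibbs nu V))) *
          ENNReal.ofReal (Real.exp (∫ x, W x y ∂μ) * h y) ∂(gibbs nu V) := by
          refine lintegral_mono fun y => ?_
          rw [← ENNReal.ofReal_mul' (hh0 y).le, ← ENNReal.ofReal_mul (by positivity)]
          refine ENNReal.ofReal_le_ofReal ?_
          have h0 := hh0 y
          calc β y * Real.exp (-W x y) * α x * h y
              = Real.exp (-W x y) * (β y * α x) * h y := by ring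
            -- One factor `C` bounds `e^{-W}`, the other comes from the bound on the product of
            -- potentials.
            _ ≤ C * (C * (Real.exp (∫ x, W x y ∂μ) *
                Real.exp (∫ y, W x y ∂(gibbs nu V)))) * h y := by
                refine mul_le_mul_of_nonneg_right (mul_le_mul (hW.exp_le x y) (hup x y) ?_
                  (by positivity)) h0.le
                exact mul_nonneg (hβ.pos y).le (hα ▸ (hW.swap.dualPot_pos hβ x).le)
            _ = _ := by ring
      _ = ENNReal.ofReal (C * C * Real.exp (∫ y, W x y ∂(gibbs nu V))) *
          ∫⁻ y, ENNReal.ofReal (Real.exp (∫ x, W x y ∂μ) * h y) ∂(gibbs nu V) :=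
          lintegral_const_mul' _ _ ENNReal.ofReal_ne_top
      _ ≤ ENNReal.ofReal (C * C * Real.exp (∫ y, W x y ∂(gibbs nu V))) * ENNReal.ofReal H := by
          gcongr
      _ = _ := by
          rw [← ENNReal.ofReal_mul (by positivity)]
          congr 1
          ring
  · refine Measure.le_iff.2 fun E hE => ?_
    rw [withDensity_apply _ hE, ← lintegral_indicator_one hE (μ := Kernel.withDensity _ _ _),
      kernel_lintegral hV hF hk' x (measurable_one.indicator hE), ← lintegral_indicator hE]
    refine lintegral_mono fun y => ?_
    by_cases hy : y ∈ E
    · simp only [indicator_of_mem hy, Pi.one_apply, mul_one]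
      refine ENNReal.ofReal_le_ofReal ?_
      calc κ * Real.exp (-W x y) ≤ β y * α x * Real.exp (-W x y) := by
            gcongr
            exact hlow x y
        _ = _ := by ring
    · simp [indicator_of_notMem hy]

end Densities

/-! ### A minorizing measure on compact sub-level sets. -/

section Minorization

variable {X Y : Type*} [TopologicalSpace X] [MeasurableSpace Y]
  [TopologicalSpace Y]

/-- A minorizing measure for all transitions with given bounds, on a sub-level set of `e^{δU}`. -/
theorem exists_minorization [BorelSpace Y] [T2Space Y] {η : Measure Y} [IsProbabilityMeasure η]
    {W : X → Y → ℝ} (hWloc : LocallyBdd (Function.uncurry W)) {U : X → ℝ} {V : Y → ℝ}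
    (hUc : ∀ r : ℝ, IsCompact {x | U x ≤ r}) (hVc : ∀ r : ℝ, IsCompact {y | V y ≤ r})
    {δ : ℝ} (hδ : 0 < δ) {κ : ℝ} (hκ : 0 < κ) {r : ℝ} (hr : 0 < r) :
    ∃ ν₀ : Measure Y, IsFiniteMeasure ν₀ ∧ 0 < ν₀.real univ ∧
      ∀ x, Real.exp (δ * U x) ≤ r →
        ν₀ ≤ η.withDensity (fun y => ENNReal.ofReal (κ * Real.exp (-W x y))) := by
  -- The sub-level sets of `V` exhaust the space, so one of them is charged by `η`.
  obtain ⟨n, hn⟩ : ∃ n : ℕ, 0 < η {y | V y ≤ n} := by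
    by_contra! hcon
    have h0 : η (⋃ n : ℕ, {y | V y ≤ n}) = 0 :=
      measure_iUnion_null fun n => le_antisymm (hcon n) zero_le
    have h1 : (⋃ n : ℕ, {y | V y ≤ n}) = univ := by
      refine eq_univ_of_forall fun y => mem_iUnion.2 ?_
      exact exists_nat_ge (V y)
    rw [h1, measure_univ] at h0
    exact one_ne_zero h0
  have hKm : MeasurableSet {y | V y ≤ n} := (hVc n).isClosed.measurableSet
  -- `W` is bounded on the product of two compact sub-level sets, so `e^{-W} ≥ e^{-M}` there.
  obtain ⟨M, hM⟩ := hWloc.exists_bound ((hUc (Real.log r / δ)).prod (hVc n))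
  set K := {y | V y ≤ n} with hK
  refine ⟨ENNReal.ofReal (κ * Real.exp (-M)) • η.restrict K,
    Measure.smul_finite _ ENNReal.ofReal_ne_top, ?_, fun x hx => ?_⟩
  · rw [measureReal_ennreal_smul_apply, measureReal_restrict_apply .univ, univ_inter,
      ENNReal.toReal_ofReal (by positivity)]
    exact mul_pos (by positivity) (ENNReal.toReal_pos hn.ne' (measure_ne_top _ _))
  · have hxU : U x ≤ Real.log r / δ := by
      rw [le_div_iff₀ hδ, mul_comm]
      exact (Real.le_log_iff_exp_le hr).2 hx
    refine Measure.le_iff.2 fun E hE => ?_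
    rw [Measure.smul_apply, Measure.restrict_apply hE, smul_eq_mul, withDensity_apply _ hE,
      ← setLIntegral_const]
    calc _ ≤ ∫⁻ y in E ∩ K, ENNReal.ofReal (κ * Real.exp (-W x y)) ∂η := by
          refine setLIntegral_mono' (hE.inter hKm) fun y hy => ENNReal.ofReal_le_ofReal ?_
          have : W x y ≤ M := (le_abs_self _).trans (hM (x, y) ⟨hxU, hy.2⟩)
          gcongr
      _ ≤ _ := lintegral_mono_set inter_subset_left

end Minorization


/-! ### Consequences of condition (A), uniform over all transitions with the same bounds. -/

section Lyapunov

variable {X Y : Type*} [MeasurableSpace X] [MeasurableSpace Y]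

theorem exp_le_mul_exp {s t θ : ℝ} (h : Real.exp (-(s - t)) ≤ θ) :
    Real.exp t ≤ θ * Real.exp s := by
  calc Real.exp t = Real.exp (-(s - t)) * Real.exp s := by rw [← Real.exp_add]; congr 1; ring
    _ ≤ _ := by gcongr

/-- Boundedness of `θ` gives `e^ϖ ≤ T e^{δU}`, so `e^{2δU}` dominates `e^{ϖ + δU}` up to the factor
`T`. This supplies the constants `D` and `H`. -/
theorem exists_exp_integrability [TopologicalSpace X] {μ : Measure X} [IsFiniteMeasure μ]
    {U ϖ θ : X → ℝ} {δ : ℝ} (hϖ : Measurable ϖ) (hθ : MemBZero θ)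
    (hdom : ∀ x, Real.exp (-(δ * U x - ϖ x)) ≤ θ x)
    (hint : Integrable (fun x => Real.exp (2 * δ * U x)) μ) :
    Integrable (fun x => Real.exp (ϖ x)) μ ∧ ∃ H : ℝ, 0 < H ∧
      ∫⁻ x, ENNReal.ofReal (Real.exp (ϖ x) * Real.exp (δ * U x)) ∂μ ≤ ENNReal.ofReal H := by
  obtain ⟨T, hT, hθT⟩ := hθ.exists_bound
  have hle : ∀ x, Real.exp (ϖ x) ≤ T * Real.exp (δ * U x) := fun x =>
    (exp_le_mul_exp (hdom x)).trans (by gcongr; exact hθT x)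
  have hsq : ∀ x, Real.exp (2 * δ * U x) = Real.exp (δ * U x) * Real.exp (δ * U x) := fun x => by
    rw [← Real.exp_add]; congr 1; ring
  refine ⟨((hint.add (integrable_const 1)).const_mul T).mono' hϖ.exp.aestronglyMeasurable
    -- The added `1` keeps `H` visibly positive.
    (ae_of_all _ fun x => ?_), T * ∫ x, Real.exp (2 * δ * U x) ∂μ + 1, ?_, ?_⟩
  · rw [Real.norm_of_nonneg (Real.exp_pos _).le, Pi.add_apply, hsq]
    refine (hle x).trans (mul_le_mul_of_nonneg_left ?_ hT.le)
    nlinarith [sq_nonneg (Real.exp (δ * U x) - 1), Real.exp_pos (δ * U x)]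
  · have : 0 ≤ ∫ x, Real.exp (2 * δ * U x) ∂μ := integral_nonneg fun x => (Real.exp_pos _).le
    positivity
  · calc _ ≤ ∫⁻ x, ENNReal.ofReal (T * Real.exp (2 * δ * U x)) ∂μ := by
          refine lintegral_mono fun x => ENNReal.ofReal_le_ofReal ?_
          rw [hsq, ← mul_assoc]
          gcongr
          exact hle x
      _ = ENNReal.ofReal (T * ∫ x, Real.exp (2 * δ * U x) ∂μ) := by
          rw [← ofReal_integral_eq_lintegral_ofReal (hint.const_mul T)
            (ae_of_all _ fun x => by dsimp only [Pi.zero_apply]; positivity), integral_const_mul]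
      _ ≤ _ := ENNReal.ofReal_le_ofReal (by linarith)

variable {η : Measure Y} {W : X → Y → ℝ} {h : Y → ℝ} {ϖ U θ : X → ℝ} {κ B δ : ℝ}

/-- The constant is chosen before the kernel: it depends on the kernel only through `B`, hence
serves the whole iteration. -/
theorem exists_transition_drift [TopologicalSpace X] (hU : LocallyBdd U) (hθ : MemBZero θ)
    (hdom : ∀ x, Real.exp (-(δ * U x - ϖ x)) ≤ θ x) (hδ : 0 < δ) (hB : 0 < B) :
    ∃ c : ℝ, 0 ≤ c ∧ ∀ K : Kernel X Y, TransitionBounds η W h ϖ κ B K → ∀ x,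
      ∫⁻ y, ENNReal.ofReal (h y) ∂(K x) ≤ ENNReal.ofReal (Real.exp (δ * U x) / 4 + c) := by
  obtain ⟨c, hc, hle⟩ := hθ.exists_drift hU hδ hB
  refine ⟨c, hc, fun K hK x => (hK.drift x).trans (ENNReal.ofReal_le_ofReal ?_)⟩
  refine le_trans ?_ (hle x)
  gcongr
  exact exp_le_mul_exp (hdom x)

theorem exists_weightedNorm_bound [TopologicalSpace X] (hθ : MemBZero θ)
    (hdom : ∀ x, Real.exp (-(δ * U x - ϖ x)) ≤ θ x) (hB : 0 < B) :
    ∃ S : ℝ≥0∞, S < ∞ ∧ ∀ K : Kernel X Y, TransitionBounds η W h ϖ κ B K →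
      weightedNorm (fun x => Real.exp (δ * U x)) h K ≤ S := by
  obtain ⟨T, hT, hθT⟩ := hθ.exists_bound
  refine ⟨ENNReal.ofReal (B * T), ENNReal.ofReal_lt_top, fun K hK => iSup_le fun x =>
    ENNReal.div_le_of_le_mul ((hK.drift x).trans ?_)⟩
  rw [← ENNReal.ofReal_mul (by positivity), mul_assoc]
  refine ENNReal.ofReal_le_ofReal ?_
  gcongr
  exact (exp_le_mul_exp (hdom x)).trans (by gcongr; exact hθT x)

theorem exists_lintegral_bind_bound {μ : Measure X} (hh : Measurable h)
    (hϖ : Integrable (fun x => Real.exp (ϖ x)) μ) :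
    ∃ S : ℝ≥0∞, S < ∞ ∧ ∀ K : Kernel X Y, TransitionBounds η W h ϖ κ B K →
      ∫⁻ y, ENNReal.ofReal (h y) ∂(μ.bind K) ≤ S := by
  refine ⟨∫⁻ x, ENNReal.ofReal (B * Real.exp (ϖ x)) ∂μ, (hϖ.const_mul B).lintegral_lt_top,
    fun K hK => ?_⟩
  rw [Measure.lintegral_bind K.aemeasurable hh.ennreal_ofReal.aemeasurable]
  exact lintegral_mono hK.drift

end Lyapunov

/-! ### Product form of all Sinkhorn densities. -/

section Iteration

variable {X Y : Type*} [MeasurableSpace X] [MeasurableSpace Y] {lam : Measure X}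
  {nu : Measure Y} {U : X → ℝ} {V : Y → ℝ} [IsProbabilityMeasure (gibbs lam U)] {W : X → Y → ℝ} {C D : ℝ}

/-- The density `k` of a dual transition is the product of Sinkhorn potentials and `e^{-W}`. -/
def IsSinkhornDensity (lam : Measure X) (nu : Measure Y) (U : X → ℝ) (V : Y → ℝ) (W : X → Y → ℝ)
    (C D : ℝ) (k : Y → X → ℝ≥0∞) : Prop :=
  ∃ α β, SinkhornPair (gibbs lam U) (gibbs nu V) W C D α β ∧
    ∀ y x, k y x = ENNReal.ofReal (Real.exp (-U x) * α x * Real.exp (-W x y) * β y)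

theorem IsSinkhornDensity.bayesDual [IsProbabilityMeasure (gibbs nu V)]
    (hV : Measurable V)
    (hW : CostBounds (gibbs lam U) (gibbs nu V) W C D) {k : Y → X → ℝ≥0∞}
    (hk : IsSinkhornDensity lam nu U V W C D k) :
    IsSinkhornDensity nu lam V U (fun y x => W x y) C D (bayesDual nu V k) := by
  obtain ⟨α, β, hp, hk⟩ := hk
  have hβ : IsPotential (gibbs nu V) β := (hp.next hW).isPotential
  exact ⟨β, _, hp.next hW, bayesDual_eq hV hW.swap hβ
    (fun x => mul_pos (Real.exp_pos (-U x)) (hp.isPotential.pos x)) hk⟩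

theorem IsSinkhornDensity.isMarkovKernel [SFinite lam]
    (hU : Measurable U)
    (hW : CostBounds (gibbs lam U) (gibbs nu V) W C D) {k : Y → X → ℝ≥0∞}
    (hk : IsSinkhornDensity lam nu U V W C D k) :
    IsMarkovKernel ((Kernel.const Y lam).withDensity k) := by
  obtain ⟨α, β, hp, hk⟩ := hk
  exact isMarkovKernel_of_density hU hW.swap hp.isPotential hp.eq_dualPot hk

theorem IsSinkhornDensity.transitionBounds [IsProbabilityMeasure (gibbs nu V)] [SFinite nu]
    (hV : Measurable V)
    (hW : CostBounds (gibbs lam U) (gibbs nu V) W C D) {k : Y → X → ℝ≥0∞}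
    (hk : IsSinkhornDensity lam nu U V W C D k) {h : Y → ℝ} (hh : Measurable h)
    (hh0 : ∀ y, 0 < h y) {H : ℝ}
    (hH : ∫⁻ y, ENNReal.ofReal (Real.exp (∫ x, W x y ∂(gibbs lam U)) * h y) ∂(gibbs nu V) ≤
      ENNReal.ofReal H) :
    TransitionBounds (gibbs nu V) W h (fun x => ∫ y, W x y ∂(gibbs nu V)) ((C * D) ^ 2 * C)⁻¹
      (C * C * H) ((Kernel.const X nu).withDensity (Sinkhorn.bayesDual nu V k)) := by
  obtain ⟨α, β, hp, hk⟩ := hk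
  have hβ : IsPotential (gibbs nu V) β := (hp.next hW).isPotential
  exact transitionBounds_of_density hV hW hβ rfl (bayesDual_eq hV hW.swap hβ
    (fun x => mul_pos (Real.exp_pos (-U x)) (hp.isPotential.pos x)) hk)
    (hp.le_mul_next hW) (hp.mul_next_le hW) hh hh0 hH

theorem isSinkhornDensity_odd [IsProbabilityMeasure (gibbs nu V)]
    (hU : Measurable U) (hV : Measurable V)
    (hW : CostBounds (gibbs lam U) (gibbs nu V) W C D) (n : ℕ) :
    IsSinkhornDensity lam nu U V W C D (oddDensity lam nu U V W n) := by
  induction n with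
  | zero =>
    have hp := hW.sinkhornPair_one
    -- The initial density `e^{-W}` has product form with both factors equal to `1`.
    refine ⟨_, _, hp, bayesDual_eq hU hW hp.isPotential (b := fun _ => 1) (fun _ => one_pos) ?_⟩
    intro x y
    simp [evenDensity]
  -- Two half steps, with the spaces exchanged in each, return to the original orientation.
  | succ n ih => exact (ih.bayesDual hV hW).bayesDual hU hW.swap

end Iteration

end Sinkhorn

end

/-! ### Assembly of the uniform estimates. -/

theorem mainTheorem2
    {X : Type*} [TopologicalSpace X] [PolishSpace X] [LocallyCompactSpace X]
    [MeasurableSpace X] [BorelSpace X]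
    {Y : Type*} [TopologicalSpace Y] [PolishSpace Y] [LocallyCompactSpace Y]
    [MeasurableSpace Y] [BorelSpace Y]
    (lam : Measure X) [IsLocallyFiniteMeasure lam]
    (nu : Measure Y) [IsLocallyFiniteMeasure nu]
    (U : X → ℝ) (V : Y → ℝ) (W : X → Y → ℝ)
    (hμ : IsProbabilityMeasure (Sinkhorn.gibbs lam U))
    (hη : IsProbabilityMeasure (Sinkhorn.gibbs nu V))
    (hWmeas : Measurable (Function.uncurry W))
    (hWmarkov : ∀ x, ∫⁻ y, ENNReal.ofReal (Real.exp (-W x y)) ∂nu = 1)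
    (hUloc : Sinkhorn.LocallyBdd U) (hVloc : Sinkhorn.LocallyBdd V)
    (hWloc : Sinkhorn.LocallyBdd (Function.uncurry W))
    (hWbdd : ∃ C : ℝ, ∀ x y, Real.exp (-W x y) ≤ C)
    (hUcpt : ∀ r : ℝ, IsCompact {x | U x ≤ r}) (hVcpt : ∀ r : ℝ, IsCompact {y | V y ≤ r})
    (δ : ℝ) (hA : Sinkhorn.ConditionA lam nu U V W δ)
    (g : X → ℝ) (hg : g = fun x => Real.exp (δ * U x))
    (h : Y → ℝ) (hh : h = fun y => Real.exp (δ * V y)) :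
    -- the Sinkhorn recursion is well posed
    (∀ n : ℕ, IsMarkovKernel (Sinkhorn.kernelEven lam nu U V W n) ∧
      IsMarkovKernel (Sinkhorn.kernelOdd lam nu U V W n)) ∧
    (∃ a : ℝ, 0 < a ∧ ∃ ρ : ℝ, 0 < ρ ∧ ρ < 1 ∧ ∀ n : ℕ, 1 ≤ n →
      max
        (Sinkhorn.lip (fun x => 1 / 2 + a * g x) (fun y => 1 / 2 + a * h y)
          (Sinkhorn.kernelEven lam nu U V W n))
        (Sinkhorn.lip (fun y => 1 / 2 + a * h y) (fun x => 1 / 2 + a * g x)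
          (Sinkhorn.kernelOdd lam nu U V W n)) ≤ ENNReal.ofReal ρ) ∧
    (⨆ (n : ℕ) (_ : 1 ≤ n),
      max (∫⁻ y, ENNReal.ofReal (h y) ∂(Sinkhorn.piEven lam nu U V W n))
        (∫⁻ x, ENNReal.ofReal (g x) ∂(Sinkhorn.piOdd lam nu U V W n))) < ∞ ∧
    (⨆ (n : ℕ) (_ : 1 ≤ n),
      max (Sinkhorn.weightedNorm g h (Sinkhorn.kernelEven lam nu U V W n))
        (Sinkhorn.weightedNorm h g (Sinkhorn.kernelOdd lam nu U V W n))) < ∞ := by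
  subst hg hh
  obtain ⟨hδ, -, hUint, hVint, hWr, hWl, θu, θv, hθu, hθv, hdomu, hdomv⟩ := hA
  have hU : Measurable U := Sinkhorn.measurable_of_isCompact_sublevel hUcpt
  have hV : Measurable V := Sinkhorn.measurable_of_isCompact_sublevel hVcpt
  have hg : Measurable fun x => Real.exp (δ * U x) := (hU.const_mul δ).exp
  have hh : Measurable fun y => Real.exp (δ * V y) := (hV.const_mul δ).exp
  set μ := Sinkhorn.gibbs lam U with hμdef
  set η := Sinkhorn.gibbs nu V with hηdef
  have hWV : Measurable fun x => ∫ y, W x y ∂η :=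
    (hWmeas.stronglyMeasurable.integral_prod_right (ν := η)).measurable
  have hWU : Measurable fun y => ∫ x, W x y ∂μ :=
    ((hWmeas.comp measurable_swap).stronglyMeasurable.integral_prod_right (ν := μ)
      (f := fun y x => W x y)).measurable
  obtain ⟨hexpu, Hu, hHu, hHule⟩ := Sinkhorn.exists_exp_integrability hWV hθu hdomu
    (Sinkhorn.integrable_exp_two_mul hU hUint)
  obtain ⟨hexpv, Hv, hHv, hHvle⟩ := Sinkhorn.exists_exp_integrability hWU hθv hdomv
    (Sinkhorn.integrable_exp_two_mul hV hVint)
  obtain ⟨C, hC⟩ : ∃ C : ℝ, 1 ≤ C ∧ ∀ x y, Real.exp (-W x y) ≤ C := by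
    obtain ⟨C, hC⟩ := hWbdd
    exact ⟨max 1 C, le_max_left _ _, fun x y => (hC x y).trans (le_max_right _ _)⟩
  obtain ⟨D, hW⟩ : ∃ D : ℝ, Sinkhorn.CostBounds μ η W C D :=
    ⟨max 1 (max (∫ y, Real.exp (∫ x, W x y ∂μ) ∂η) (∫ x, Real.exp (∫ y, W x y ∂η) ∂μ)),
      hWmeas, hC.1, le_max_left _ _, hC.2, hWl, hWr, hexpv, hexpu,
      (le_max_left _ _).trans (le_max_right _ _), (le_max_right _ _).trans (le_max_right _ _)⟩
  have hC1 := hW.one_le_C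
  have hD1 := hW.one_le_D
  have hodd := Sinkhorn.isSinkhornDensity_odd hU hV hW
  set κ := ((C * D) ^ 2 * C)⁻¹ with hκdef
  have hκ : 0 < κ := by positivity
  -- The index `n + 1` is where `n ≥ 1` enters: these bounds are for Bayes duals of densities that
  -- already have the invariant, so the first two transitions are not covered.
  have hTe : ∀ n, Sinkhorn.TransitionBounds η W (fun y => Real.exp (δ * V y))
      (fun x => ∫ y, W x y ∂η) κ (C * C * Hv) (Sinkhorn.kernelEven lam nu U V W (n + 1)) :=
    fun n => (hodd n).transitionBounds hV hW hh (fun y => Real.exp_pos _) hHvle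
  have hTo : ∀ n, Sinkhorn.TransitionBounds μ (fun y x => W x y) (fun x => Real.exp (δ * U x))
      (fun y => ∫ x, W x y ∂μ) κ (C * C * Hu) (Sinkhorn.kernelOdd lam nu U V W (n + 1)) :=
    fun n => ((hodd n).bayesDual hV hW).transitionBounds hU hW.swap hg (fun y => Real.exp_pos _)
      hHule
  have hBe : 0 < C * C * Hv := by positivity
  have hBo : 0 < C * C * Hu := by positivity
  refine ⟨fun n => ⟨?_, (hodd n).isMarkovKernel hU hW⟩, ?_, ?_, ?_⟩
  · cases n with
    | zero =>
      refine ⟨fun x => ⟨?_⟩⟩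
      rw [Sinkhorn.kernelEven, Kernel.withDensity_apply' _ hWmeas.neg.exp.ennreal_ofReal,
        Measure.restrict_univ, Kernel.const_apply]
      exact hWmarkov x
    | succ n => exact (hTe n).isMarkovKernel
  · obtain ⟨ce, hce, hde⟩ := Sinkhorn.exists_transition_drift (η := η) (W := W)
      (h := fun y => Real.exp (δ * V y)) (κ := κ) hUloc hθu hdomu hδ hBe
    obtain ⟨co, hco, hdo⟩ := Sinkhorn.exists_transition_drift (η := μ) (W := fun y x => W x y)
      (h := fun x => Real.exp (δ * U x)) (κ := κ) hVloc hθv hdomv hδ hBo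
    -- A common drift constant, and below a common minorization mass `b`, allow the same `a` and the
    -- same rate in both directions.
    set c := max ce co with hcdef
    have hc : 0 ≤ c := hce.trans (le_max_left _ _)
    have hr : 0 < 16 * c + 8 := by positivity
    have hWloc' : Sinkhorn.LocallyBdd (Function.uncurry fun y x => W x y) := fun z => by
      obtain ⟨N, hN, M, hM⟩ := hWloc z.swap
      exact ⟨_, continuous_swap.continuousAt hN, M, fun w hw => hM w.swap hw⟩
    obtain ⟨νe, hνe, hνe0, hme⟩ := Sinkhorn.exists_minorization (η := η) hWloc hUcpt hVcpt hδ hκ hr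
    obtain ⟨νo, hνo, hνo0, hmo⟩ := Sinkhorn.exists_minorization (η := μ) hWloc' hVcpt hUcpt hδ hκ hr
    set b := min 1 (min (νe.real univ) (νo.real univ)) with hbdef
    have hb : 0 < b := lt_min one_pos (lt_min hνe0 hνo0)
    have hb1 : b ≤ 1 := min_le_left _ _
    have ha1 : b / (8 * c + 8) < 1 := by
      rw [div_lt_one (by positivity)]
      linarith
    have ha0 : 0 < b / (8 * c + 8) := by positivity
    refine ⟨b / (8 * c + 8), ha0, 1 - b / (8 * c + 8), by linarith, by linarith, fun n hn => ?_⟩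
    obtain ⟨n, rfl⟩ := Nat.exists_eq_add_of_le' hn
    have := (hTe n).isMarkovKernel
    have := (hTo n).isMarkovKernel
    refine max_le ?_ ?_
    · exact Sinkhorn.lip_le_of_drift_of_minorization hg (fun x => Real.exp_pos _) hh
        (fun y => Real.exp_pos _) hc hb hb1
        (fun x => (hde _ (hTe n) x).trans (ENNReal.ofReal_le_ofReal
          (by linarith [le_max_left ce co]))) νe
        ((min_le_right _ _).trans (min_le_left _ _))
        (fun x hx => (hme x hx).trans ((hTe n).minor x))
    · exact Sinkhorn.lip_le_of_drift_of_minorization hh (fun y => Real.exp_pos _) hg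
        (fun x => Real.exp_pos _) hc hb hb1
        (fun y => (hdo _ (hTo n) y).trans (ENNReal.ofReal_le_ofReal
          (by linarith [le_max_right ce co]))) νo
        ((min_le_right _ _).trans (min_le_right _ _))
        (fun y hy => (hmo y hy).trans ((hTo n).minor y))
  · obtain ⟨Se, hSe, hle⟩ := Sinkhorn.exists_lintegral_bind_bound (η := η) (W := W) (κ := κ)
      (B := C * C * Hv) (μ := μ) hh hexpu
    obtain ⟨So, hSo, hlo⟩ := Sinkhorn.exists_lintegral_bind_bound (η := μ)
      (W := fun y x => W x y) (κ := κ) (B := C * C * Hu) (μ := η) hg hexpv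
    refine lt_of_le_of_lt (iSup₂_le fun n hn => ?_) (max_lt hSe hSo)
    obtain ⟨n, rfl⟩ := Nat.exists_eq_add_of_le' hn
    exact max_le_max (hle _ (hTe n)) (hlo _ (hTo n))
  · obtain ⟨Se, hSe, hle⟩ := Sinkhorn.exists_weightedNorm_bound (η := η) (W := W)
      (h := fun y => Real.exp (δ * V y)) (κ := κ) hθu hdomu hBe
    obtain ⟨So, hSo, hlo⟩ := Sinkhorn.exists_weightedNorm_bound (η := μ)
      (W := fun y x => W x y) (h := fun x => Real.exp (δ * U x)) (κ := κ) hθv hdomv hBo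
    refine lt_of_le_of_lt (iSup₂_le fun n hn => ?_) (max_lt hSe hSo)
    obtain ⟨n, rfl⟩ := Nat.exists_eq_add_of_le' hn
    exact max_le_max (hle _ (hTe n)) (hlo _ (hTo n))
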